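/- Let $n\ge 0$ and let $\mathbb S_{++}^n$ be the set of real symmetric positive definite $n\times n$ matrices. Let $\mathcal M_{\rm bw}$ be $\mathbb S_{++}^n$, an open subset of the space of symmetric matrices, with the Bures--Wasserstein Riemannian metric $g_X(U,V)=\tfrac12\operatorname{tr}(\mathcal L_X[U]\,V)$ for symmetric $U,V$, where $\mathcal L_X[U]$ is the unique solution $S$ of $SX+XS=U$. A geodesic of $\mathcal M_{\rm bw}$ from $X$ to $Y$ is a $C^2$ curve $\gamma:[0,1]\to\mathbb S_{++}^n$ with $\gamma(0)=X$, $\gamma(1)=Y$ and zero covariant acceleration for the Levi-Civita connection of $g$. Let $\mathcal N_0(\Sigma)$ be the centred Gaussian measure on $\mathbb R^n$ with covariance matrix $\Sigma$, and let $$\mathcal W_2(\mu,\nu)=\Bigl(\inf_{\pi}\int |x-y|^2\,d\pi(x,y)\Bigr)^{1/2},$$ the infimum being over all couplings $\pi$ of $\mu$ and $\nu$. A geodesic of $(\{\mathcal N_0(\Sigma):\Sigma\in\mathbb S_{++}^n\},\mathcal W_2)$ from $\mu$ to $\nu$ is a curve $(\mu_t)_{t\in[0,1]}$ in this set with $\mu_0=\mu$,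 $\mu_1=\nu$, $\mathcal W_2(\mu,\nu)<\infty$ and $\mathcal W_2(\mu_s,\mu_t)=|s-t|\,\mathcal W_2(\mu,\nu)$ for all $s,t\in[0,1]$. Let $X,Y\in\mathbb S_{++}^n$. 1. For every geodesic $\gamma$ of $\mathcal M_{\rm bw}$ from $X$ to $Y$, the curve $t\mapsto\mathcal N_0(\gamma(t))$, $t\in[0,1]$, is a geodesic of $(\{\mathcal N_0(\Sigma):\Sigma\in\mathbb S_{++}^n\},\mathcal W_2)$ from $\mathcal N_0(X)$ to $\mathcal N_0(Y)$. 2. There is a unique unitary polar factor $P$ of $Y^{1/2}X^{1/2}$, that is, a unique orthogonal $P$ with $Y^{1/2}X^{1/2}=PH$ for some symmetric positive semidefinite $H$. The curve $$\gamma(t)=\bigl((1-t)X^{1/2}+tY^{1/2}P\bigr)\bigl((1-t)X^{1/2}+tY^{1/2}P\bigr)^{\top}$$ is a geodesic of $\mathcal M_{\rm bw}$ from $X$ to $Y$. 3. With this $P$, $Y^{1/2}PX^{-1/2}=Y^{1/2}(Y^{1/2}XY^{1/2})^{-1/2}Y^{1/2}$, and this matrix is an optimal transport map from $\mathcal N_0(X)$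 to $\mathcal N_0(Y)$: with $T$ the linear map it defines, $T_\#\mathcal N_0(X)=\mathcal N_0(Y)$ and $\int|x-Tx|^2\,d\mathcal N_0(X)(x)=\mathcal W_2(\mathcal N_0(X),\mathcal N_0(Y))^2$. -/

import Mathlib

open MeasureTheory ProbabilityTheory Set
open scoped ENNReal Matrix MatrixOrder

noncomputable section

namespace BuresWasserstein

/-! ### The Bures-Wasserstein geometry of symmetric positive definite matrices -/

/-- The linear operator `S ↦ S X + X S` on `n × n` matrices. -/
def sylvester {n : ℕ} (X : Matrix (Fin n) (Fin n) ℝ) :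
    Module.End ℝ (Matrix (Fin n) (Fin n) ℝ) :=
  LinearMap.mulRight ℝ X + LinearMap.mulLeft ℝ X

/-- The Lyapunov operator `L_X`: for `X` positive definite, `L_X[U]` is the unique solution `S` of
`S X + X S = U` (see `lyapunov_spec` and `eq_lyapunov`). -/
def lyapunov {n : ℕ} (X U : Matrix (Fin n) (Fin n) ℝ) : Matrix (Fin n) (Fin n) ℝ :=
  Ring.inverse (sylvester X) U

/-- The Bures-Wasserstein metric `g_X(U, V) = (1/2) tr (L_X[U] V)`; the base points `X` are the
symmetric positive definite matrices, the tangent vectors `U`, `V` the symmetric matrices. -/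
def bwMetric {n : ℕ} (X U V : Matrix (Fin n) (Fin n) ℝ) : ℝ :=
  (1 / 2) * (lyapunov X U * V).trace

/-- The derivative at `X` in the direction `W` of the function `Z ↦ g_Z(U, V)`. -/
def bwMetricDeriv {n : ℕ} (X W U V : Matrix (Fin n) (Fin n) ℝ) : ℝ :=
  deriv (fun r : ℝ => bwMetric (X + r • W) U V) 0

/-- The Christoffel symbols of the first kind of the Levi-Civita connection of the metric, in the
global linear chart of the open cone of positive definite matrices: for constant vector fields
`U`, `W`, `V` this is `g_X(∇_U W, V)`. -/
def bwChristoffel {n : ℕ} (X U W V : Matrix (Fin n) (Fin n) ℝ) : ℝ :=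
  (1 / 2) * (bwMetricDeriv X U W V + bwMetricDeriv X W U V - bwMetricDeriv X V U W)

/-- The entrywise derivative of a curve of matrices on `[0, 1]` (one-sided at the end points). -/
def curveDeriv {n : ℕ} (γ : ℝ → Matrix (Fin n) (Fin n) ℝ) (t : ℝ) :
    Matrix (Fin n) (Fin n) ℝ :=
  Matrix.of fun i j => derivWithin (fun s => γ s i j) (Icc 0 1) t

/-- The inner product `g_{γ(t)}(∇_{γ'(t)} γ'(t), V)` of the covariant acceleration of `γ` with a
tangent vector `V`. -/
def bwAcceleration {n : ℕ} (γ : ℝ → Matrix (Fin n) (Fin n) ℝ) (t : ℝ)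
    (V : Matrix (Fin n) (Fin n) ℝ) : ℝ :=
  bwMetric (γ t) (curveDeriv (curveDeriv γ) t) V +
    bwChristoffel (γ t) (curveDeriv γ t) (curveDeriv γ t) V

/-- `γ : [0, 1] → S₊₊ⁿ` is a geodesic (a curve of zero covariant acceleration) from `X` to `Y` on
the Riemannian manifold of positive definite matrices with the Bures-Wasserstein metric. -/
structure IsBWGeodesic {n : ℕ} (γ : ℝ → Matrix (Fin n) (Fin n) ℝ)
    (X Y : Matrix (Fin n) (Fin n) ℝ) : Prop where
  posDef : ∀ t ∈ Icc (0 : ℝ) 1, (γ t).PosDef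
  contDiffOn : ∀ i j, ContDiffOn ℝ 2 (fun t => γ t i j) (Icc 0 1)
  source : γ 0 = X
  target : γ 1 = Y
  acceleration_eq_zero : ∀ t ∈ Icc (0 : ℝ) 1, ∀ V : Matrix (Fin n) (Fin n) ℝ, V.IsSymm →
    bwAcceleration γ t V = 0

/-- `P` is the orthogonal factor in a polar decomposition `M = P H`: `P` is orthogonal and `H` is
symmetric positive semidefinite. -/
def IsPolarFactor {n : ℕ} (P M : Matrix (Fin n) (Fin n) ℝ) : Prop :=
  P ∈ Matrix.orthogonalGroup (Fin n) ℝ ∧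
    ∃ H : Matrix (Fin n) (Fin n) ℝ, H.PosSemidef ∧ M = P * H

/-- The curve `((1-t) X^{1/2} + t Y^{1/2} P) ((1-t) X^{1/2} + t Y^{1/2} P)ᵀ`. -/
def bwCurve {n : ℕ} (X Y P : Matrix (Fin n) (Fin n) ℝ) (t : ℝ) : Matrix (Fin n) (Fin n) ℝ :=
  ((1 - t) • CFC.sqrt X + t • (CFC.sqrt Y * P)) *
    ((1 - t) • CFC.sqrt X + t • (CFC.sqrt Y * P))ᵀ

/-! ### The Wasserstein geometry of centred Gaussian measures -/

/-- The centred Gaussian measure on `ℝⁿ` with covariance matrix `S`. -/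
def centredGaussian {n : ℕ} (S : Matrix (Fin n) (Fin n) ℝ) :
    Measure (EuclideanSpace ℝ (Fin n)) :=
  multivariateGaussian 0 S

/-- The `L²`-Wasserstein distance: the square root of the infimum of `∫ |x - y|² dπ(x, y)` over the
couplings `π` of `μ` and `ν`. -/
def wasserstein {n : ℕ} (μ ν : Measure (EuclideanSpace ℝ (Fin n))) : ℝ≥0∞ :=
  (⨅ π ∈ {π : Measure (EuclideanSpace ℝ (Fin n) × EuclideanSpace ℝ (Fin n)) |
      π.fst = μ ∧ π.snd = ν}, ∫⁻ z, edist z.1 z.2 ^ 2 ∂π) ^ (1 / 2 : ℝ)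

/-- `m` is a (minimizing, constant speed) geodesic from `μ` to `ν`, parametrized by `[0, 1]`, in the
space of centred nondegenerate Gaussian measures with the `L²`-Wasserstein distance. -/
structure IsGaussianWassersteinGeodesic {n : ℕ} (m : ℝ → Measure (EuclideanSpace ℝ (Fin n)))
    (μ ν : Measure (EuclideanSpace ℝ (Fin n))) : Prop where
  mem : ∀ t ∈ Icc (0 : ℝ) 1, ∃ S : Matrix (Fin n) (Fin n) ℝ, S.PosDef ∧ m t = centredGaussian S
  source : m 0 = μ
  target : m 1 = ν
  finite : wasserstein μ ν ≠ ∞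
  dist_eq : ∀ s ∈ Icc (0 : ℝ) 1, ∀ t ∈ Icc (0 : ℝ) 1,
    wasserstein (m s) (m t) = ENNReal.ofReal |s - t| * wasserstein μ ν

/-- `T` is an optimal transport map from `μ` to `ν` for the quadratic cost. -/
structure IsOptimalTransportMap {n : ℕ}
    (T : EuclideanSpace ℝ (Fin n) → EuclideanSpace ℝ (Fin n))
    (μ ν : Measure (EuclideanSpace ℝ (Fin n))) : Prop where
  measurable : Measurable T
  map_eq : μ.map T = ν
  cost_eq : ∫⁻ x, edist x (T x) ^ 2 ∂μ = wasserstein μ ν ^ 2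

/-! ### The Lyapunov operator is well defined -/

lemma isUnit_sylvester {n : ℕ} {X : Matrix (Fin n) (Fin n) ℝ} (hX : X.PosDef) :
    IsUnit (sylvester X) := by
  rw [LinearMap.isUnit_iff_ker_eq_bot, LinearMap.ker_eq_bot']
  intro S hS
  have h0 : S * X + X * S = 0 := by simpa [sylvester] using hS
  have h1 : (S * X * Sᴴ).PosSemidef := hX.posSemidef.mul_mul_conjTranspose_same S
  have h2 : (Sᴴ * X * S).PosSemidef := hX.posSemidef.conjTranspose_mul_mul_same S
  have h3 : (S * X * Sᴴ).trace + (Sᴴ * X * S).trace = 0 := by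
    rw [Matrix.trace_mul_comm (S * X) Sᴴ, ← Matrix.trace_add, Matrix.mul_assoc Sᴴ X S,
      ← Matrix.mul_add, h0, Matrix.mul_zero, Matrix.trace_zero]
  have h4 : (Sᴴ * X * S).trace = 0 := by
    linarith [h1.trace_nonneg, h2.trace_nonneg]
  have h5 : Sᴴ * X * S = 0 := (h2.trace_eq_zero_iff).1 h4
  by_contra hne
  obtain ⟨v, hv⟩ : ∃ v, S *ᵥ v ≠ 0 := by
    by_contra! h
    exact hne (Matrix.ext_of_mulVec_single fun i => by rw [h, Matrix.zero_mulVec])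
  have h6 := hX.dotProduct_mulVec_pos hv
  have h7 : star v ⬝ᵥ ((Sᴴ * X * S) *ᵥ v) = star (S *ᵥ v) ⬝ᵥ (X *ᵥ (S *ᵥ v)) := by
    rw [Matrix.star_mulVec, ← Matrix.dotProduct_mulVec, Matrix.mulVec_mulVec, Matrix.mulVec_mulVec,
      Matrix.mul_assoc]
  rw [h5] at h7
  simp at h7
  simp [← h7] at h6

lemma lyapunov_spec {n : ℕ} {X : Matrix (Fin n) (Fin n) ℝ} (hX : X.PosDef)
    (U : Matrix (Fin n) (Fin n) ℝ) : lyapunov X U * X + X * lyapunov X U = U := by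
  have h := congrArg (fun f : Module.End ℝ (Matrix (Fin n) (Fin n) ℝ) => f U)
    (Ring.mul_inverse_cancel _ (isUnit_sylvester hX))
  simpa [lyapunov, sylvester] using h

lemma eq_lyapunov {n : ℕ} {X S U : Matrix (Fin n) (Fin n) ℝ} (hX : X.PosDef)
    (h : S * X + X * S = U) : S = lyapunov X U := by
  have h' := congrArg (fun f : Module.End ℝ (Matrix (Fin n) (Fin n) ℝ) => f S)
    (Ring.inverse_mul_cancel _ (isUnit_sylvester hX))
  have hs : sylvester X S = U := by simpa [sylvester] using h
  simpa [lyapunov, hs] using h'.symm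

end BuresWasserstein

end

/-!
The argument rests on positive definite matrices acting as transport maps.

For a positive definite `A`, the linear map `A` sends `N(0, S)` to `N(0, A S A)`
(`map_centredGaussian`), and it is optimal by Kantorovich duality. The inequality
`⟨x, (1 - A) x⟩ + ⟨y, (1 - A⁻¹) y⟩ ≤ |x - y| ^ 2` (`dual_potentials_le`) integrates, against any
coupling, to a lower bound that depends only on the covariances and that `A` attains. Hence
`W₂(N(0, S), N(0, A S A)) ^ 2 = tr ((1 - A) S (1 - A))` (`wasserstein_eq`). The matrix
`A = Y^{1/2} P X^{-1/2}` made from the polar factor `P` of `Y^{1/2} X^{1/2}` is the positive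
definite solution of `A X A = Y` (`transport_of_isPolarFactor`), so it is the
optimal map from `N(0, X)` to `N(0, Y)`.

On the Riemannian side, differentiating `S X + X S = U` expresses the Christoffel symbols through
the Lyapunov operator. The covariant acceleration of `γ` vanishes exactly if `γ'' = 2 S γ S`, where
`S = L_γ[γ']` (`acceleration_eq_zero_iff`). This is equivalent to `S' = -S ^ 2`, and together with
`γ' = S γ + γ S` it integrates to `γ t = (1 + t S₀) γ₀ (1 + t S₀)`, by uniqueness for linear
differential equations (`eq_conj_one_add_smul_of_ode`, `IsBWGeodesic.exists_eq`). Conversely these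
curves are geodesics while `1 + t S₀` is positive definite (`isBWGeodesic_conj`), and the curve made
from the polar factor is the one with `S₀ = A - 1`.

The two sides meet because a geodesic stays among positive definite matrices: `1 + t S₀` is then
invertible on all of `[0, 1]`, which excludes eigenvalues of `S₀` in `(-∞, -1]` and makes it
positive definite (`posDef_one_add_smul`). The matrices `1 + t S₀` commute, so
`(1 + t S₀) (1 + s S₀)⁻¹` is positive definite and maps `γ s` to `γ t`. The distance formula gives
`W₂(γ s, γ t) = |s - t| √(tr (S₀ X S₀))` (`wasserstein_conj`).
-/

namespace BuresWasserstein

/-! ### Polar factors and the linear transport map -/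

lemma posDef_sqrt {n : ℕ} {X : Matrix (Fin n) (Fin n) ℝ} (hX : X.PosDef) :
    (CFC.sqrt X).PosDef :=
  Matrix.isStrictlyPositive_iff_posDef.1
    (IsStrictlyPositive.sqrt X (Matrix.isStrictlyPositive_iff_posDef.2 hX))

lemma sqrt_mul_sqrt {n : ℕ} {X : Matrix (Fin n) (Fin n) ℝ} (hX : X.PosDef) :
    CFC.sqrt X * CFC.sqrt X = X :=
  CFC.sqrt_mul_sqrt_self X hX.posSemidef.nonneg

lemma transpose_eq_self {n : ℕ} {X : Matrix (Fin n) (Fin n) ℝ} (hX : X.PosSemidef) : Xᵀ = X := by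
  simpa [Matrix.conjTranspose_eq_transpose_of_trivial] using hX.isHermitian.eq

lemma isUnit_det {n : ℕ} {X : Matrix (Fin n) (Fin n) ℝ} (hX : X.PosDef) : IsUnit X.det :=
  hX.det_pos.ne'.isUnit

/-- The symmetric factor of a polar decomposition is determined by `H ^ 2 = Mᵀ M`. -/
lemma polar_symm_factor {n : ℕ} {P H M : Matrix (Fin n) (Fin n) ℝ}
    (hP : P ∈ Matrix.orthogonalGroup (Fin n) ℝ) (hH : H.PosSemidef) (hM : M = P * H) :
    H = CFC.sqrt (Mᵀ * M) := by
  refine (CFC.sqrt_unique ?_ hH.nonneg).symm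
  have hP' : Pᵀ * P = 1 := (Matrix.mem_orthogonalGroup_iff' _ _).1 hP
  rw [hM, Matrix.transpose_mul, transpose_eq_self hH, Matrix.mul_assoc, ← Matrix.mul_assoc Pᵀ, hP',
    Matrix.one_mul]

lemma posDef_transpose_mul_self {n : ℕ} {M : Matrix (Fin n) (Fin n) ℝ} (hM : IsUnit M.det) :
    (Mᵀ * M).PosDef := by
  simpa [Matrix.conjTranspose_eq_transpose_of_trivial] using Matrix.PosDef.conjTranspose_mul_self M
    (Matrix.mulVec_injective_iff_isUnit.2 ((Matrix.isUnit_iff_isUnit_det M).2 hM))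

/-- An invertible matrix `M` has exactly one polar factor, `M (Mᵀ M)^{-1/2}`. -/
theorem existsUnique_isPolarFactor {n : ℕ} {M : Matrix (Fin n) (Fin n) ℝ} (hM : IsUnit M.det) :
    ∃! P : Matrix (Fin n) (Fin n) ℝ, IsPolarFactor P M := by
  have hG := posDef_transpose_mul_self hM
  have hH := posDef_sqrt hG
  have hu := isUnit_det hH
  refine ⟨M * (CFC.sqrt (Mᵀ * M))⁻¹, ⟨?_, CFC.sqrt (Mᵀ * M), hH.posSemidef, ?_⟩, ?_⟩
  · rw [Matrix.mem_orthogonalGroup_iff']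
    have hs := sqrt_mul_sqrt hG
    have ht := transpose_eq_self hH.posSemidef
    generalize CFC.sqrt (Mᵀ * M) = H at *
    calc (M * H⁻¹)ᵀ * (M * H⁻¹) = H⁻¹ * (Mᵀ * M) * H⁻¹ := by
          rw [Matrix.transpose_mul, Matrix.transpose_nonsing_inv, ht]
          simp only [Matrix.mul_assoc]
      _ = (H⁻¹ * H) * (H * H⁻¹) := by rw [← hs]; simp only [Matrix.mul_assoc]
      _ = 1 := by rw [Matrix.nonsing_inv_mul _ hu, Matrix.mul_nonsing_inv _ hu, Matrix.one_mul]
  · rw [Matrix.nonsing_inv_mul_cancel_right _ _ hu]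
  · rintro P ⟨hP, H, hH', h⟩
    rw [← polar_symm_factor hP hH' h]
    rw [← polar_symm_factor hP hH' h] at hu
    rw [h, Matrix.mul_nonsing_inv_cancel_right _ _ hu]

/-- The data attached to the polar factor `P` of `Y^{1/2} X^{1/2}`: the matrix
`A = Y^{1/2} P X^{-1/2}` equals `X^{-1/2} H X^{-1/2}`, with `H` the symmetric factor. It is
therefore the positive definite solution of `A X A = Y`. -/
theorem transport_of_isPolarFactor {n : ℕ} {X Y P : Matrix (Fin n) (Fin n) ℝ} (hX : X.PosDef)
    (hY : Y.PosDef) (hP : IsPolarFactor P (CFC.sqrt Y * CFC.sqrt X)) :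
    (CFC.sqrt Y * P * (CFC.sqrt X)⁻¹).PosDef ∧
      (CFC.sqrt Y * P * (CFC.sqrt X)⁻¹) * X * (CFC.sqrt Y * P * (CFC.sqrt X)⁻¹) = Y ∧
      CFC.sqrt Y * P * (CFC.sqrt X)⁻¹ =
        CFC.sqrt Y * (CFC.sqrt (CFC.sqrt Y * X * CFC.sqrt Y))⁻¹ * CFC.sqrt Y := by
  obtain ⟨hP, H, hH, h⟩ := hP
  have hx := posDef_sqrt hX
  have hy := posDef_sqrt hY
  have hxx := sqrt_mul_sqrt hX
  have hyy := sqrt_mul_sqrt hY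
  generalize CFC.sqrt X = x at *
  generalize CFC.sqrt Y = y at *
  have hxT := transpose_eq_self hx.posSemidef
  have hyT := transpose_eq_self hy.posSemidef
  have hHT := transpose_eq_self hH
  have hxu := isUnit_det hx
  have hP1 : Pᵀ * P = 1 := (Matrix.mem_orthogonalGroup_iff' _ _).1 hP
  have hP2 : P * Pᵀ = 1 := (Matrix.mem_orthogonalGroup_iff _ _).1 hP
  have h1 : Pᵀ * (y * x) = H := by rw [h, ← Matrix.mul_assoc, hP1, Matrix.one_mul]
  have h2 : x * y * P = H := by
    rw [← hHT, ← h1]; simp [Matrix.transpose_mul, hxT, hyT]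
  have hHu : IsUnit H.det := by
    rw [← h1, Matrix.det_mul, Matrix.det_mul]
    refine IsUnit.mul ?_ ((isUnit_det hy).mul hxu)
    exact IsUnit.of_mul_eq_one _ (by rw [← Matrix.det_mul, hP1, Matrix.det_one])
  have hHpd : H.PosDef := hH.posDef_iff_isUnit.2 ((Matrix.isUnit_iff_isUnit_det H).2 hHu)
  have hA : y * P * x⁻¹ = x⁻¹ * H * x⁻¹ := by
    rw [← h2, Matrix.mul_assoc x, Matrix.nonsing_inv_mul_cancel_left _ _ hxu]
  have hApd : (y * P * x⁻¹).PosDef := by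
    rw [hA]
    have := hHpd.mul_mul_conjTranspose_same (B := x⁻¹)
      (Matrix.vecMul_injective_iff_isUnit.2 ((Matrix.isUnit_iff_isUnit_det _).2
        (isUnit_det hx.inv)))
    rwa [Matrix.conjTranspose_eq_transpose_of_trivial, Matrix.transpose_nonsing_inv, hxT] at this
  refine ⟨hApd, ?_, ?_⟩
  · have hAT := transpose_eq_self hApd.posSemidef
    calc y * P * x⁻¹ * X * (y * P * x⁻¹) = y * P * x⁻¹ * X * (y * P * x⁻¹)ᵀ := by rw [hAT]
      _ = y * P * (x⁻¹ * x) * (x * x⁻¹) * Pᵀ * y := by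
        rw [← hxx]
        simp only [Matrix.transpose_mul, Matrix.transpose_nonsing_inv, hxT, hyT, Matrix.mul_assoc]
      _ = Y := by
        rw [Matrix.nonsing_inv_mul _ hxu, Matrix.mul_nonsing_inv _ hxu, Matrix.mul_one,
          Matrix.mul_one, Matrix.mul_assoc y, hP2, Matrix.mul_one, hyy]
  · have hs : CFC.sqrt (y * X * y) = P * H * Pᵀ := by
      refine CFC.sqrt_unique ?_ ?_
      · calc P * H * Pᵀ * (P * H * Pᵀ) = P * H * (Pᵀ * P) * H * Pᵀ := by
              simp only [Matrix.mul_assoc]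
          _ = (P * H) * (P * H)ᵀ := by
              rw [hP1, Matrix.mul_one, Matrix.transpose_mul, hHT]
              simp only [Matrix.mul_assoc]
          _ = y * X * y := by
              rw [← h, ← hxx, Matrix.transpose_mul, hxT, hyT]
              simp only [Matrix.mul_assoc]
      · have := hH.mul_mul_conjTranspose_same P
        rw [Matrix.conjTranspose_eq_transpose_of_trivial] at this
        exact this.nonneg
    have hi : (P * H * Pᵀ)⁻¹ = P * H⁻¹ * Pᵀ := by
      refine Matrix.inv_eq_right_inv ?_
      calc P * H * Pᵀ * (P * H⁻¹ * Pᵀ) = P * (H * ((Pᵀ * P) * H⁻¹)) * Pᵀ := by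
            simp only [Matrix.mul_assoc]
        _ = 1 := by rw [hP1, Matrix.one_mul, Matrix.mul_nonsing_inv _ hHu, Matrix.mul_one, hP2]
    have h3 : Pᵀ * y = H * x⁻¹ := by
      rw [← h1, ← Matrix.mul_assoc, Matrix.mul_nonsing_inv_cancel_right _ _ hxu]
    rw [hs, hi]
    calc y * P * x⁻¹ = y * P * (H⁻¹ * H) * x⁻¹ := by
          rw [Matrix.nonsing_inv_mul _ hHu, Matrix.mul_one]
      _ = y * P * H⁻¹ * (H * x⁻¹) := by simp only [Matrix.mul_assoc]
      _ = y * (P * H⁻¹ * Pᵀ) * y := by rw [← h3]; simp only [Matrix.mul_assoc]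

/-! ### Wasserstein distance of centred Gaussian measures -/

instance isGaussian_centredGaussian {n : ℕ} (S : Matrix (Fin n) (Fin n) ℝ) :
    IsGaussian (centredGaussian S) := by
  unfold centredGaussian; infer_instance

lemma memLp_apply_centredGaussian {n : ℕ} (S : Matrix (Fin n) (Fin n) ℝ) (i : Fin n) :
    MemLp (fun x : EuclideanSpace ℝ (Fin n) => x i) 2 (centredGaussian S) :=
  (EuclideanSpace.proj i : EuclideanSpace ℝ (Fin n) →L[ℝ] ℝ).comp_memLp' IsGaussian.memLp_two_id

lemma integral_apply_centredGaussian {n : ℕ} (S : Matrix (Fin n) (Fin n) ℝ) (i : Fin n) :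
    ∫ x, x i ∂(centredGaussian S) = 0 := by
  have h := (EuclideanSpace.proj i : EuclideanSpace ℝ (Fin n) →L[ℝ] ℝ).integral_comp_id_comm
    (μ := centredGaussian S) IsGaussian.integrable_id
  rw [centredGaussian, integral_id_multivariateGaussian] at h
  simpa [centredGaussian] using h

lemma integral_mul_centredGaussian {n : ℕ} {S : Matrix (Fin n) (Fin n) ℝ} (hS : S.PosSemidef)
    (i j : Fin n) : ∫ x, x i * x j ∂(centredGaussian S) = S i j := by
  have h := covariance_eval_multivariateGaussian (μ := 0) hS i j
  have h' := covariance_eq_sub (memLp_apply_centredGaussian S i) (memLp_apply_centredGaussian S j)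
  rw [integral_apply_centredGaussian, integral_apply_centredGaussian] at h'
  rw [centredGaussian] at *
  rw [h] at h'
  simpa using h'.symm

lemma inner_toEuclideanCLM_eq_sum {n : ℕ} (B : Matrix (Fin n) (Fin n) ℝ)
    (x y : EuclideanSpace ℝ (Fin n)) :
    inner ℝ x (Matrix.toEuclideanCLM (𝕜 := ℝ) B y) = ∑ i, ∑ j, B i j * (x i * y j) := by
  rw [Matrix.inner_toEuclideanCLM]
  simp only [dotProduct, Matrix.mulVec, Finset.mul_sum]
  exact Finset.sum_congr rfl fun i _ => Finset.sum_congr rfl fun j _ => by ring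

lemma integrable_quadratic_centredGaussian {n : ℕ} (S B : Matrix (Fin n) (Fin n) ℝ) :
    Integrable (fun x => inner ℝ x (Matrix.toEuclideanCLM (𝕜 := ℝ) B x)) (centredGaussian S) := by
  simp only [inner_toEuclideanCLM_eq_sum]
  exact integrable_finsetSum _ fun i _ => integrable_finsetSum _ fun j _ =>
    ((memLp_apply_centredGaussian S i).integrable_mul (memLp_apply_centredGaussian S j)).const_mul _

/-- The expectation of a quadratic form under a centred Gaussian measure. -/
lemma integral_quadratic_centredGaussian {n : ℕ} {S : Matrix (Fin n) (Fin n) ℝ}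
    (hS : S.PosSemidef) (B : Matrix (Fin n) (Fin n) ℝ) :
    ∫ x, inner ℝ x (Matrix.toEuclideanCLM (𝕜 := ℝ) B x) ∂(centredGaussian S) =
      (B * S).trace := by
  have hi (i j : Fin n) : Integrable (fun x : EuclideanSpace ℝ (Fin n) => B i j * (x i * x j))
      (centredGaussian S) :=
    ((memLp_apply_centredGaussian S i).integrable_mul (memLp_apply_centredGaussian S j)).const_mul _
  simp only [inner_toEuclideanCLM_eq_sum]
  rw [integral_finsetSum _ fun i _ => integrable_finsetSum _ fun j _ => hi i j]
  simp only [Matrix.trace, Matrix.diag, Matrix.mul_apply]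
  refine Finset.sum_congr rfl fun i _ => ?_
  rw [integral_finsetSum _ fun j _ => hi i j]
  refine Finset.sum_congr rfl fun j _ => ?_
  rw [integral_const_mul, integral_mul_centredGaussian hS i j]
  congr 1
  simpa using (hS.isHermitian.apply j i)

lemma adjoint_toEuclideanCLM {n : ℕ} (B : Matrix (Fin n) (Fin n) ℝ) :
    ContinuousLinearMap.adjoint (Matrix.toEuclideanCLM (𝕜 := ℝ) B) =
      Matrix.toEuclideanCLM (𝕜 := ℝ) Bᵀ := by
  rw [← Matrix.conjTranspose_eq_transpose_of_trivial]
  exact (map_star (Matrix.toEuclideanCLM (n := Fin n) (𝕜 := ℝ)) B).symm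

/-- A linear map with matrix `A` sends `N(0, S)` to `N(0, A S Aᵀ)`. -/
lemma map_centredGaussian {n : ℕ} {S A : Matrix (Fin n) (Fin n) ℝ} (hS : S.PosSemidef) :
    (centredGaussian S).map (Matrix.toEuclideanCLM (𝕜 := ℝ) A) = centredGaussian (A * S * Aᵀ) := by
  have hT : (A * S * Aᵀ).PosSemidef := by
    simpa [Matrix.conjTranspose_eq_transpose_of_trivial] using hS.mul_mul_conjTranspose_same A
  apply Measure.ext_of_charFun
  ext t
  have h0 : charFun ((centredGaussian S).map (Matrix.toEuclideanCLM (𝕜 := ℝ) A)) t =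
      charFun (centredGaussian S) (Matrix.toEuclideanCLM (𝕜 := ℝ) Aᵀ t) := by
    rw [charFun_apply, charFun_apply, integral_map (by fun_prop) (by fun_prop)]
    simp_rw [← adjoint_toEuclideanCLM, ContinuousLinearMap.adjoint_inner_right]
  rw [h0, centredGaussian, centredGaussian, charFun_multivariateGaussian hS,
    charFun_multivariateGaussian hT]
  simp only [inner_zero_right, Matrix.ofLp_toEuclideanCLM]
  congr 4
  rw [Matrix.mulVec_transpose, ← Matrix.mulVec_mulVec, ← Matrix.mulVec_mulVec,
    Matrix.dotProduct_mulVec t.ofLp A, Matrix.mulVec_transpose]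

/-- The cost of transporting `N(0, S)` by the linear map with matrix `A`. -/
lemma lintegral_cost_linear {n : ℕ} {S A : Matrix (Fin n) (Fin n) ℝ} (hS : S.PosSemidef) :
    ∫⁻ x, edist x (Matrix.toEuclideanCLM (𝕜 := ℝ) A x) ^ 2 ∂(centredGaussian S) =
      ENNReal.ofReal (((1 - A) * S * (1 - A)ᵀ).trace) := by
  have h (x : EuclideanSpace ℝ (Fin n)) : edist x (Matrix.toEuclideanCLM (𝕜 := ℝ) A x) ^ 2 =
      ENNReal.ofReal (inner ℝ x (Matrix.toEuclideanCLM (𝕜 := ℝ) ((1 - A)ᵀ * (1 - A)) x)) := by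
    rw [edist_dist, ← ENNReal.ofReal_pow dist_nonneg, dist_eq_norm, map_mul,
      ← adjoint_toEuclideanCLM, mul_apply_eq_comp,
      ContinuousLinearMap.adjoint_inner_right, real_inner_self_eq_norm_sq]
    simp
  simp_rw [h]
  rw [← ofReal_integral_eq_lintegral_ofReal (integrable_quadratic_centredGaussian _ _),
    integral_quadratic_centredGaussian hS, Matrix.mul_assoc, Matrix.trace_mul_comm,
    Matrix.mul_assoc]
  refine Filter.Eventually.of_forall fun x => ?_
  simp only [Pi.zero_apply]
  rw [map_mul, ← adjoint_toEuclideanCLM, mul_apply_eq_comp,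
    ContinuousLinearMap.adjoint_inner_right]
  exact real_inner_self_nonneg

lemma ofReal_integral_le_lintegral_ofReal {α : Type*} [MeasurableSpace α] {μ : Measure α}
    {f : α → ℝ} (hf : Integrable f μ) :
    ENNReal.ofReal (∫ x, f x ∂μ) ≤ ∫⁻ x, ENNReal.ofReal (f x) ∂μ := by
  rw [integral_eq_lintegral_pos_part_sub_lintegral_neg_part hf]
  refine (ENNReal.ofReal_le_ofReal (sub_le_self _ ENNReal.toReal_nonneg)).trans
    ENNReal.ofReal_toReal_le

/-- Kantorovich duality for the pair of quadratic potentials of a positive definite `A`: the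
pointwise bound that makes the gradient `A` of a convex quadratic function an optimal map. -/
lemma dual_potentials_le {n : ℕ} {A : Matrix (Fin n) (Fin n) ℝ} (hA : A.PosDef)
    (x y : EuclideanSpace ℝ (Fin n)) :
    inner ℝ x (Matrix.toEuclideanCLM (𝕜 := ℝ) (1 - A) x) +
      inner ℝ y (Matrix.toEuclideanCLM (𝕜 := ℝ) (1 - A⁻¹) y) ≤ dist x y ^ 2 := by
  -- the difference of the two sides is the quadratic form of `A` at `x - A⁻¹ y`
  have h0 : 0 ≤ inner ℝ (x - Matrix.toEuclideanCLM (𝕜 := ℝ) A⁻¹ y)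
      (Matrix.toEuclideanCLM (𝕜 := ℝ) A (x - Matrix.toEuclideanCLM (𝕜 := ℝ) A⁻¹ y)) := by
    rw [Matrix.inner_toEuclideanCLM]
    simpa using hA.posSemidef.dotProduct_mulVec_nonneg
      (x - Matrix.toEuclideanCLM (𝕜 := ℝ) A⁻¹ y).ofLp
  have h1 : Matrix.toEuclideanCLM (𝕜 := ℝ) A (Matrix.toEuclideanCLM (𝕜 := ℝ) A⁻¹ y) = y := by
    rw [← mul_apply_eq_comp, ← map_mul,
      Matrix.mul_nonsing_inv _ hA.det_pos.ne'.isUnit, map_one, one_apply_eq_self]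
  have hAT : Aᵀ = A := transpose_eq_self hA.posSemidef
  have h2 : inner ℝ (Matrix.toEuclideanCLM (𝕜 := ℝ) A⁻¹ y) (Matrix.toEuclideanCLM (𝕜 := ℝ) A x) =
      inner ℝ x y := by
    rw [← ContinuousLinearMap.adjoint_inner_left, adjoint_toEuclideanCLM, hAT, h1,
      real_inner_comm]
  rw [dist_eq_norm, ← real_inner_self_eq_norm_sq]
  simp only [map_sub, h1, inner_sub_left, inner_sub_right, h2] at h0
  simp only [map_sub, map_one, sub_apply, one_apply_eq_self,
    inner_sub_right, inner_sub_left]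
  rw [real_inner_comm x y] at *
  rw [real_inner_comm y (Matrix.toEuclideanCLM (𝕜 := ℝ) A⁻¹ y)] at *
  linarith

/-- Every coupling of `N(0, S)` and `N(0, A S A)`, with `A` positive definite, costs at least as
much as the linear map `A`. -/
lemma cost_le_of_coupling {n : ℕ} {S A : Matrix (Fin n) (Fin n) ℝ} (hS : S.PosSemidef)
    (hA : A.PosDef) {π : Measure (EuclideanSpace ℝ (Fin n) × EuclideanSpace ℝ (Fin n))}
    (h1 : π.fst = centredGaussian S) (h2 : π.snd = centredGaussian (A * S * A)) :
    ENNReal.ofReal (((1 - A) * S * (1 - A)).trace) ≤ ∫⁻ z, edist z.1 z.2 ^ 2 ∂π := by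
  have hAT : Aᵀ = A := transpose_eq_self hA.posSemidef
  have hT : (A * S * A).PosSemidef := by
    simpa [Matrix.conjTranspose_eq_transpose_of_trivial, hAT] using hS.mul_mul_conjTranspose_same A
  set q : EuclideanSpace ℝ (Fin n) → ℝ :=
    fun x => inner ℝ x (Matrix.toEuclideanCLM (𝕜 := ℝ) (1 - A) x)
  set r : EuclideanSpace ℝ (Fin n) → ℝ :=
    fun y => inner ℝ y (Matrix.toEuclideanCLM (𝕜 := ℝ) (1 - A⁻¹) y)
  have hqi : Integrable q (π.map Prod.fst) := by
    rw [← Measure.fst, h1]; exact integrable_quadratic_centredGaussian _ _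
  have hri : Integrable r (π.map Prod.snd) := by
    rw [← Measure.snd, h2]; exact integrable_quadratic_centredGaussian _ _
  have hq' : Integrable (fun z => q z.1) π := hqi.comp_measurable measurable_fst
  have hr' : Integrable (fun z => r z.2) π := hri.comp_measurable measurable_snd
  have hqe : ∫ z, q z.1 ∂π = ((1 - A) * S).trace := by
    rw [← integral_map measurable_fst.aemeasurable hqi.aestronglyMeasurable, ← Measure.fst, h1,
      integral_quadratic_centredGaussian hS]
  have hre : ∫ z, r z.2 ∂π = ((1 - A⁻¹) * (A * S * A)).trace := by
    rw [← integral_map measurable_snd.aemeasurable hri.aestronglyMeasurable, ← Measure.snd, h2,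
      integral_quadratic_centredGaussian hT]
  have hsum : ∫ z, (q z.1 + r z.2) ∂π = ((1 - A) * S * (1 - A)).trace := by
    rw [integral_add hq' hr', hqe, hre]
    have : A⁻¹ * (A * S * A) = S * A := by
      rw [Matrix.mul_assoc A, Matrix.nonsing_inv_mul_cancel_left _ _ hA.det_pos.ne'.isUnit]
    simp only [Matrix.sub_mul, Matrix.mul_sub, Matrix.one_mul, Matrix.mul_one, this,
      Matrix.trace_sub]
    ring
  rw [← hsum]
  refine (ofReal_integral_le_lintegral_ofReal (hq'.add hr')).trans (lintegral_mono fun z => ?_)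
  rw [edist_dist, ← ENNReal.ofReal_pow dist_nonneg]
  exact ENNReal.ofReal_le_ofReal (dual_potentials_le hA z.1 z.2)

lemma trace_cost_nonneg {n : ℕ} {S A : Matrix (Fin n) (Fin n) ℝ} (hS : S.PosSemidef)
    (hA : Aᵀ = A) : 0 ≤ ((1 - A) * S * (1 - A)).trace := by
  have := hS.mul_mul_conjTranspose_same (1 - A)
  simp only [Matrix.conjTranspose_eq_transpose_of_trivial, Matrix.transpose_sub,
    Matrix.transpose_one, hA] at this
  exact this.trace_nonneg

/-- The Wasserstein distance between two centred Gaussian measures that are related by a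
positive definite linear map. -/
lemma wasserstein_eq {n : ℕ} {S A : Matrix (Fin n) (Fin n) ℝ} (hS : S.PosSemidef)
    (hA : A.PosDef) :
    wasserstein (centredGaussian S) (centredGaussian (A * S * A)) =
      ENNReal.ofReal (√(((1 - A) * S * (1 - A)).trace)) := by
  have hAT : Aᵀ = A := transpose_eq_self hA.posSemidef
  have hinf : ⨅ π ∈ {π : Measure (EuclideanSpace ℝ (Fin n) × EuclideanSpace ℝ (Fin n)) |
      π.fst = centredGaussian S ∧ π.snd = centredGaussian (A * S * A)},
      ∫⁻ z, edist z.1 z.2 ^ 2 ∂π = ENNReal.ofReal (((1 - A) * S * (1 - A)).trace) := by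
    refine le_antisymm ?_ (le_iInf₂ fun π hπ => cost_le_of_coupling hS hA hπ.1 hπ.2)
    have hm : Measurable fun x : EuclideanSpace ℝ (Fin n) =>
        (x, Matrix.toEuclideanCLM (𝕜 := ℝ) A x) := by fun_prop
    have h1 : ((centredGaussian S).map fun x => (x, Matrix.toEuclideanCLM (𝕜 := ℝ) A x)).fst =
        centredGaussian S := by
      rw [Measure.fst, Measure.map_map measurable_fst hm]
      exact Measure.map_id
    have h2 : ((centredGaussian S).map fun x => (x, Matrix.toEuclideanCLM (𝕜 := ℝ) A x)).snd =
        centredGaussian (A * S * A) := by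
      rw [Measure.snd, Measure.map_map measurable_snd hm]
      exact (map_centredGaussian hS).trans (by rw [hAT])
    refine iInf_le_of_le _ (iInf_le_of_le ⟨h1, h2⟩ (le_of_eq ?_))
    rw [lintegral_map (by fun_prop) hm, lintegral_cost_linear hS, Matrix.transpose_sub,
      Matrix.transpose_one, hAT]
  have hnn := trace_cost_nonneg hS hAT
  rw [wasserstein, hinf, Real.sqrt_eq_rpow, ENNReal.ofReal_rpow_of_nonneg hnn (by norm_num)]

/-- A positive definite linear map is an optimal transport map between centred Gaussians. -/
theorem isOptimalTransportMap_of_posDef {n : ℕ} {S A : Matrix (Fin n) (Fin n) ℝ}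
    (hS : S.PosSemidef) (hA : A.PosDef) :
    IsOptimalTransportMap (Matrix.toEuclideanCLM (𝕜 := ℝ) A) (centredGaussian S)
      (centredGaussian (A * S * A)) := by
  have hAT : Aᵀ = A := transpose_eq_self hA.posSemidef
  refine ⟨by fun_prop, by rw [map_centredGaussian hS, hAT], ?_⟩
  have hnn := trace_cost_nonneg hS hAT
  rw [lintegral_cost_linear hS, wasserstein_eq hS hA, ← ENNReal.ofReal_pow (Real.sqrt_nonneg _),
    Real.sq_sqrt hnn, Matrix.transpose_sub, Matrix.transpose_one, hAT]

/-! ### Symmetry and trace identities for the Lyapunov operator -/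

lemma transpose_lyapunov {n : ℕ} {X U : Matrix (Fin n) (Fin n) ℝ} (hX : X.PosDef) (hU : Uᵀ = U) :
    (lyapunov X U)ᵀ = lyapunov X U := by
  refine eq_lyapunov hX ?_
  have h := congrArg Matrix.transpose (lyapunov_spec hX U)
  rwa [Matrix.transpose_add, Matrix.transpose_mul, Matrix.transpose_mul,
    transpose_eq_self hX.posSemidef, hU, add_comm] at h

lemma trace_lyapunov_mul {n : ℕ} {X : Matrix (Fin n) (Fin n) ℝ} (hX : X.PosDef)
    (U V : Matrix (Fin n) (Fin n) ℝ) :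
    (lyapunov X U * V).trace = (U * lyapunov X V).trace := by
  have hU := lyapunov_spec hX U
  have hV := lyapunov_spec hX V
  generalize lyapunov X U = S at *
  generalize lyapunov X V = T at *
  have h : (S * (T * X)).trace = (X * (S * T)).trace := by
    rw [← Matrix.mul_assoc, Matrix.trace_mul_comm]
  rw [← hU, ← hV]
  simp only [Matrix.mul_add, Matrix.add_mul, Matrix.trace_add, Matrix.mul_assoc, h]
  ring

/-! ### Differential equations in a normed algebra -/

section NormedAlgebra

variable {R : Type*} [NormedRing R] [NormedAlgebra ℝ R]

variable (R) in
/-- The operator `S ↦ S X + X S` as a bounded operator depending linearly on `X`. -/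
noncomputable def sylvesterCLM : R →L[ℝ] R →L[ℝ] R :=
  (ContinuousLinearMap.mul ℝ R).flip + ContinuousLinearMap.mul ℝ R

@[simp]
lemma sylvesterCLM_apply (X S : R) : sylvesterCLM R X S = S * X + X * S := rfl

lemma coe_sylvesterCLM (X : R) :
    ((sylvesterCLM R X : R →L[ℝ] R) : Module.End ℝ R) =
      LinearMap.mulRight ℝ X + LinearMap.mulLeft ℝ X := rfl

lemma isUnit_sylvesterCLM [FiniteDimensional ℝ R] {X : R}
    (hX : IsUnit (LinearMap.mulRight ℝ X + LinearMap.mulLeft ℝ X : Module.End ℝ R)) :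
    IsUnit (sylvesterCLM R X) := by
  obtain ⟨u, hu⟩ := hX
  rw [← coe_sylvesterCLM] at hu
  refine ⟨⟨_, LinearMap.toContinuousLinearMap (↑u⁻¹ : Module.End ℝ R), ?_, ?_⟩, rfl⟩
  · ext1 U
    have h := congrArg (fun f : Module.End ℝ R => f U) u.mul_inv
    rwa [hu] at h
  · ext1 U
    have h := congrArg (fun f : Module.End ℝ R => f U) u.inv_mul
    rwa [hu] at h

/-- The inverse in the ring of bounded operators has the same values as the inverse in the ring of
linear endomorphisms. -/
lemma inverse_sylvester_apply {X : R} (hX : IsUnit (sylvesterCLM R X)) (U : R) :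
    Ring.inverse (LinearMap.mulRight ℝ X + LinearMap.mulLeft ℝ X : Module.End ℝ R) U =
      Ring.inverse (sylvesterCLM R X) U := by
  have hu : IsUnit (LinearMap.mulRight ℝ X + LinearMap.mulLeft ℝ X : Module.End ℝ R) :=
    hX.map ContinuousLinearMap.toLinearMapRingHom
  have h1 : sylvesterCLM R X (Ring.inverse (sylvesterCLM R X) U) = U :=
    congrArg (fun f => f U) (Ring.mul_inverse_cancel _ hX)
  have h2 := congrArg (fun f : Module.End ℝ R => f (Ring.inverse (sylvesterCLM R X) U))
    (Ring.inverse_mul_cancel _ hu)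
  rw [← coe_sylvesterCLM] at h2 ⊢
  simpa only [Module.End.mul_apply, Module.End.one_apply, ContinuousLinearMap.coe_coe, h1] using h2

/-- The derivative of the solution `S` of `S Z + Z S = U` along a curve of data `(Z, U)`. -/
theorem hasDerivWithinAt_inverse_sylvester [FiniteDimensional ℝ R] {Z U : ℝ → R} {Z' U' S : R}
    {s : Set ℝ} {t : ℝ} (hZ : HasDerivWithinAt Z Z' s t) (hU : HasDerivWithinAt U U' s t)
    (hu : IsUnit (LinearMap.mulRight ℝ (Z t) + LinearMap.mulLeft ℝ (Z t) : Module.End ℝ R))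
    (hS : Ring.inverse (LinearMap.mulRight ℝ (Z t) + LinearMap.mulLeft ℝ (Z t) : Module.End ℝ R)
      (U t) = S) :
    HasDerivWithinAt (fun r => Ring.inverse
      (LinearMap.mulRight ℝ (Z r) + LinearMap.mulLeft ℝ (Z r) : Module.End ℝ R) (U r))
      (Ring.inverse (LinearMap.mulRight ℝ (Z t) + LinearMap.mulLeft ℝ (Z t) : Module.End ℝ R)
        (U' - (S * Z' + Z' * S))) s t := by
  have : CompleteSpace R := FiniteDimensional.complete ℝ R
  replace hu := isUnit_sylvesterCLM hu
  have hc : HasDerivWithinAt (fun r => sylvesterCLM R (Z r)) (sylvesterCLM R Z') s t :=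
    (sylvesterCLM R).hasFDerivAt.comp_hasDerivWithinAt t hZ
  have hi : HasDerivWithinAt (fun r => Ring.inverse (sylvesterCLM R (Z r)))
      (-(Ring.inverse (sylvesterCLM R (Z t)) * sylvesterCLM R Z' *
        Ring.inverse (sylvesterCLM R (Z t)))) s t := by
    obtain ⟨u, hu⟩ := hu
    have h := hasFDerivAt_ringInverse (𝕜 := ℝ) u
    rw [hu] at h
    have h' := h.comp_hasDerivWithinAt t hc
    rw [← hu, Ring.inverse_unit]
    simpa [Function.comp_def] using h'
  have hev : ∀ᶠ r in nhdsWithin t s, IsUnit (sylvesterCLM R (Z r)) :=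
    hc.continuousWithinAt.eventually (Units.isOpen.mem_nhds hu)
  have h := (hi.clm_apply hU).congr_of_eventuallyEq
    (hev.mono fun r hr => inverse_sylvester_apply hr (U r)) (inverse_sylvester_apply hu _)
  refine h.congr_deriv ?_
  rw [inverse_sylvester_apply hu] at hS ⊢
  simp only [map_sub, neg_apply, mul_apply_eq_comp, hS, sylvesterCLM_apply]
  abel

/-- A solution of the linear equation `E' = a E + E b` that starts at zero vanishes. -/
theorem eq_zero_of_linear_ode {a b E : ℝ → R} (ha : ContinuousOn a (Icc 0 1))
    (hb : ContinuousOn b (Icc 0 1)) (h0 : E 0 = 0)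
    (hE : ∀ t ∈ Icc (0 : ℝ) 1, HasDerivWithinAt E (a t * E t + E t * b t) (Icc 0 1) t) :
    ∀ t ∈ Icc (0 : ℝ) 1, E t = 0 := by
  obtain ⟨K, hK⟩ := isCompact_Icc.exists_bound_of_continuousOn ha
  obtain ⟨L, hL⟩ := isCompact_Icc.exists_bound_of_continuousOn hb
  refine eq_zero_of_abs_deriv_le_mul_abs_self_of_eq_zero_right (K := K + L)
    (fun t ht => (hE t ht).continuousWithinAt)
    (fun t ht => (hE t ⟨ht.1, ht.2.le⟩).mono_of_mem_nhdsWithin (Icc_mem_nhdsGE_of_mem ht)) h0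
    fun t ht => ?_
  have ht' : t ∈ Icc (0 : ℝ) 1 := ⟨ht.1, ht.2.le⟩
  calc ‖a t * E t + E t * b t‖ ≤ ‖a t‖ * ‖E t‖ + ‖E t‖ * ‖b t‖ :=
        (norm_add_le _ _).trans (add_le_add (norm_mul_le _ _) (norm_mul_le _ _))
    _ ≤ K * ‖E t‖ + ‖E t‖ * L := by
        gcongr
        · exact hK t ht'
        · exact hL t ht'
    _ = (K + L) * ‖E t‖ := by ring

lemma hasDerivWithinAt_one_add_smul (S : R) (s : Set ℝ) (t : ℝ) :
    HasDerivWithinAt (fun r : ℝ => 1 + r • S) S s t := by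
  simpa using (((hasDerivAt_id' t).smul_const S).const_add 1).hasDerivWithinAt

lemma hasDerivWithinAt_conj_one_add_smul (X S : R) (s : Set ℝ) (t : ℝ) :
    HasDerivWithinAt (fun r : ℝ => (1 + r • S) * X * (1 + r • S))
      (S * X * (1 + t • S) + (1 + t • S) * X * S) s t :=
  ((hasDerivWithinAt_one_add_smul S s t).mul_const X).mul (hasDerivWithinAt_one_add_smul S s t)

lemma hasDerivWithinAt_deriv_conj_one_add_smul (X S : R) (s : Set ℝ) (t : ℝ) :
    HasDerivWithinAt (fun r : ℝ => S * X * (1 + r • S) + (1 + r • S) * X * S)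
      ((2 : ℝ) • (S * X * S)) s t := by
  have h := ((hasDerivWithinAt_one_add_smul S s t).const_mul (S * X)).add
    (((hasDerivWithinAt_one_add_smul S s t).mul_const X).mul_const S)
  rwa [← two_smul ℝ (S * X * S)] at h

/-- Integration of the geodesic equation in its first order form `γ' = S γ + γ S`, `S' = -S ^ 2`:
the solution is `γ t = (1 + t S₀) γ₀ (1 + t S₀)`. -/
theorem eq_conj_one_add_smul_of_ode {γ S : ℝ → R}
    (hγ : ∀ t ∈ Icc (0 : ℝ) 1, HasDerivWithinAt γ (S t * γ t + γ t * S t) (Icc 0 1) t)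
    (hS : ∀ t ∈ Icc (0 : ℝ) 1, HasDerivWithinAt S (-(S t * S t)) (Icc 0 1) t) :
    ∀ t ∈ Icc (0 : ℝ) 1, γ t = (1 + t • S 0) * γ 0 * (1 + t • S 0) := by
  have hc : ContinuousOn S (Icc 0 1) := fun t ht => (hS t ht).continuousWithinAt
  have hl : ∀ t ∈ Icc (0 : ℝ) 1, S t * (1 + t • S 0) - S 0 = 0 := by
    refine eq_zero_of_linear_ode (a := fun t => -S t) (b := 0) hc.neg continuousOn_const (by simp)
      fun t ht => ?_
    refine (((hS t ht).mul
      (hasDerivWithinAt_one_add_smul (S 0) (Icc 0 1) t)).sub_const (S 0)).congr_deriv ?_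
    simp only [Pi.zero_apply]
    noncomm_ring
  have hr : ∀ t ∈ Icc (0 : ℝ) 1, (1 + t • S 0) * S t - S 0 = 0 := by
    refine eq_zero_of_linear_ode (a := 0) (b := fun t => -S t) continuousOn_const hc.neg (by simp)
      fun t ht => ?_
    refine (((hasDerivWithinAt_one_add_smul (S 0) (Icc 0 1) t).mul
      (hS t ht)).sub_const (S 0)).congr_deriv ?_
    simp only [Pi.zero_apply, zero_mul]
    noncomm_ring
  have hE : ∀ t ∈ Icc (0 : ℝ) 1, γ t - (1 + t • S 0) * γ 0 * (1 + t • S 0) = 0 := by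
    refine eq_zero_of_linear_ode hc hc (by simp) fun t ht => ?_
    refine ((hγ t ht).sub
      (hasDerivWithinAt_conj_one_add_smul (γ 0) (S 0) (Icc 0 1) t)).congr_deriv ?_
    have h1 : S 0 * γ 0 * (1 + t • S 0) = S t * ((1 + t • S 0) * γ 0 * (1 + t • S 0)) := by
      rw [← mul_assoc, ← mul_assoc, sub_eq_zero.1 (hl t ht)]
    have h2 : (1 + t • S 0) * γ 0 * S 0 = (1 + t • S 0) * γ 0 * (1 + t • S 0) * S t := by
      rw [mul_assoc _ _ (S t), sub_eq_zero.1 (hr t ht)]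
    rw [h1, h2]
    noncomm_ring
  exact fun t ht => sub_eq_zero.1 (hE t ht)

end NormedAlgebra

/-! ### Derivatives of the metric and the geodesic equation -/

-- The operator norm serves only to apply the results on normed algebras: its topology is the
-- entrywise one.
open scoped Matrix.Norms.Operator in
/-- The derivative of the Lyapunov solution along a curve, found by differentiating
`S Z + Z S = U`. -/
lemma hasDerivWithinAt_lyapunov {n : ℕ} {Z U : ℝ → Matrix (Fin n) (Fin n) ℝ}
    {Z' U' : Matrix (Fin n) (Fin n) ℝ} {s : Set ℝ} {t : ℝ} (hZ : HasDerivWithinAt Z Z' s t)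
    (hU : HasDerivWithinAt U U' s t) (hpd : (Z t).PosDef) :
    HasDerivWithinAt (fun r => lyapunov (Z r) (U r))
      (lyapunov (Z t) (U' - (lyapunov (Z t) (U t) * Z' + Z' * lyapunov (Z t) (U t)))) s t :=
  hasDerivWithinAt_inverse_sylvester (R := Matrix (Fin n) (Fin n) ℝ) hZ hU (isUnit_sylvester hpd)
    rfl

lemma hasDerivWithinAt_matrix {n : ℕ} {γ : ℝ → Matrix (Fin n) (Fin n) ℝ}
    {G : Matrix (Fin n) (Fin n) ℝ} {s : Set ℝ} {t : ℝ} :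
    HasDerivWithinAt γ G s t ↔ ∀ i j, HasDerivWithinAt (fun r => γ r i j) (G i j) s t :=
  (hasDerivWithinAt_pi (φ := γ) (φ' := G)).trans (forall_congr' fun _ => hasDerivWithinAt_pi)

lemma bwMetricDeriv_eq {n : ℕ} {X : Matrix (Fin n) (Fin n) ℝ} (hX : X.PosDef)
    (W U V : Matrix (Fin n) (Fin n) ℝ) :
    bwMetricDeriv X W U V =
      -(1 / 2) * ((lyapunov X U * W + W * lyapunov X U) * lyapunov X V).trace := by
  have hZ : HasDerivWithinAt (fun r : ℝ => X + r • W) W univ 0 := by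
    refine hasDerivWithinAt_matrix.2 fun i j => HasDerivAt.hasDerivWithinAt ?_
    simpa using ((hasDerivAt_id' (0 : ℝ)).mul_const (W i j)).const_add (X i j)
  have hU : HasDerivWithinAt (fun _ : ℝ => U) 0 univ 0 :=
    hasDerivWithinAt_matrix.2 fun i j => hasDerivWithinAt_const (0 : ℝ) univ (U i j)
  have h := hasDerivWithinAt_lyapunov hZ hU (by simpa using hX)
  generalize hD : lyapunov (X + (0 : ℝ) • W) (0 - (lyapunov (X + (0 : ℝ) • W) U * W +
    W * lyapunov (X + (0 : ℝ) • W) U)) = D at h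
  have hL : HasDerivWithinAt (fun r : ℝ => (lyapunov (X + r • W) U * V).trace) (D * V).trace
      univ 0 := by
    simp only [Matrix.trace, Matrix.diag, Matrix.mul_apply]
    exact HasDerivWithinAt.fun_sum fun i _ => HasDerivWithinAt.fun_sum fun j _ =>
      (hasDerivWithinAt_matrix.1 h i j).mul_const (V j i)
  have hd := ((hL.hasDerivAt Filter.univ_mem).const_mul (1 / 2 : ℝ)).deriv
  rw [← hD, zero_smul, add_zero, zero_sub] at hd
  refine hd.trans ?_
  rw [trace_lyapunov_mul hX, Matrix.neg_mul, Matrix.trace_neg]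
  ring

/-- The covariant acceleration pairs with `V` as `Γ / 2 - S G S` pairs with the Lyapunov solution
of `V`, for a curve with position `G`, velocity `U`, second derivative `Γ` and `S = L_G[U]`. -/
lemma bwMetric_add_bwChristoffel {n : ℕ} {G : Matrix (Fin n) (Fin n) ℝ} (hG : G.PosDef)
    (U Γ V : Matrix (Fin n) (Fin n) ℝ) :
    bwMetric G Γ V + bwChristoffel G U U V =
      (((1 / 2 : ℝ) • Γ - lyapunov G U * G * lyapunov G U) * lyapunov G V).trace := by
  rw [bwMetric, trace_lyapunov_mul hG, bwChristoffel, bwMetricDeriv_eq hG, bwMetricDeriv_eq hG]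
  have hU := lyapunov_spec hG U
  have hV := lyapunov_spec hG V
  generalize lyapunov G U = S at *
  generalize lyapunov G V = T at *
  have h1 : (S * (S * (G * T))).trace = (G * (T * (S * S))).trace := by
    rw [← Matrix.mul_assoc, Matrix.trace_mul_comm]; simp only [Matrix.mul_assoc]
  have h2 : (G * (S * (S * T))).trace = (T * (G * (S * S))).trace := by
    rw [Matrix.trace_mul_comm T]; simp only [Matrix.mul_assoc]
  have h3 : (S * (G * (T * S))).trace = (S * (S * (G * T))).trace := by
    rw [Matrix.trace_mul_comm S (S * (G * T))]; simp only [Matrix.mul_assoc]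
  have h4 : (S * (T * (G * S))).trace = (T * (G * (S * S))).trace := by
    rw [Matrix.trace_mul_comm]; simp only [Matrix.mul_assoc]
  rw [← hU, ← hV]
  simp only [Matrix.mul_add, Matrix.add_mul, Matrix.trace_add, Matrix.mul_assoc, Matrix.sub_mul,
    Matrix.trace_sub, Matrix.smul_mul, Matrix.trace_smul, smul_eq_mul, h1, h2, h3, h4]
  ring

/-- The geodesic equation: the covariant acceleration vanishes exactly if `Γ = 2 S G S`. -/
lemma acceleration_eq_zero_iff {n : ℕ} {G : Matrix (Fin n) (Fin n) ℝ} (hG : G.PosDef)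
    {U Γ : Matrix (Fin n) (Fin n) ℝ} (hU : Uᵀ = U) (hΓ : Γᵀ = Γ) :
    (∀ V : Matrix (Fin n) (Fin n) ℝ, V.IsSymm → bwMetric G Γ V + bwChristoffel G U U V = 0) ↔
      Γ = (2 : ℝ) • (lyapunov G U * G * lyapunov G U) := by
  simp_rw [bwMetric_add_bwChristoffel hG]
  constructor
  · intro h
    have hS := transpose_lyapunov hG hU
    have hGT := transpose_eq_self hG.posSemidef
    generalize lyapunov G U = S at *
    set D := (1 / 2 : ℝ) • Γ - S * G * S with hD
    have hDT : Dᵀ = D := by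
      simp only [hD, Matrix.transpose_sub, Matrix.transpose_smul, Matrix.transpose_mul, hΓ, hS,
        hGT, Matrix.mul_assoc]
    -- test against the symmetric `V` whose Lyapunov solution is `D` itself
    have h' := h (D * G + G * D) (by
      simp only [Matrix.IsSymm, Matrix.transpose_add, Matrix.transpose_mul, hDT, hGT]
      exact add_comm _ _)
    rw [← eq_lyapunov hG rfl] at h'
    have h0 : D = 0 := by
      refine Matrix.trace_conjTranspose_mul_self_eq_zero_iff.1 ?_
      rwa [Matrix.conjTranspose_eq_transpose_of_trivial, hDT]
    rw [← sub_eq_zero.1 h0, smul_smul]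
    norm_num
  · intro h V _
    rw [h, smul_smul]
    norm_num

lemma curveDeriv_eq {n : ℕ} {γ : ℝ → Matrix (Fin n) (Fin n) ℝ} {G : Matrix (Fin n) (Fin n) ℝ}
    {t : ℝ} (ht : t ∈ Icc (0 : ℝ) 1) (h : HasDerivWithinAt γ G (Icc 0 1) t) :
    curveDeriv γ t = G := by
  ext i j
  exact (hasDerivWithinAt_matrix.1 h i j).derivWithin (uniqueDiffOn_Icc zero_lt_one t ht)

lemma hasDerivWithinAt_curveDeriv {n : ℕ} {γ : ℝ → Matrix (Fin n) (Fin n) ℝ} {t : ℝ}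
    (ht : t ∈ Icc (0 : ℝ) 1) (h : ∀ i j, DifferentiableOn ℝ (fun t => γ t i j) (Icc 0 1)) :
    HasDerivWithinAt γ (curveDeriv γ t) (Icc 0 1) t :=
  hasDerivWithinAt_matrix.2 fun i j => (h i j t ht).hasDerivWithinAt

lemma transpose_curveDeriv {n : ℕ} {γ : ℝ → Matrix (Fin n) (Fin n) ℝ} {t : ℝ}
    (ht : t ∈ Icc (0 : ℝ) 1) (h : ∀ r ∈ Icc (0 : ℝ) 1, (γ r)ᵀ = γ r) :
    (curveDeriv γ t)ᵀ = curveDeriv γ t := by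
  ext i j
  refine derivWithin_congr (fun r hr => ?_) ?_
  · exact congrFun (congrFun (h r hr) i) j
  · exact congrFun (congrFun (h t ht) i) j

/-! ### Solutions of the geodesic equation -/

open scoped Matrix.Norms.Operator in
/-- Along a Bures-Wasserstein geodesic, `S t = L_{γ t}[γ' t]` solves `S' = -S ^ 2`, so the geodesic
is `t ↦ (1 + t S) X (1 + t S)` for a symmetric matrix `S`. -/
theorem IsBWGeodesic.exists_eq {n : ℕ} {γ : ℝ → Matrix (Fin n) (Fin n) ℝ}
    {X Y : Matrix (Fin n) (Fin n) ℝ} (h : IsBWGeodesic γ X Y) :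
    ∃ S : Matrix (Fin n) (Fin n) ℝ, Sᵀ = S ∧
      ∀ t ∈ Icc (0 : ℝ) 1, γ t = (1 + t • S) * X * (1 + t • S) := by
  have hC (i j : Fin n) := (contDiffOn_succ_iff_derivWithin (n := 1)
    (uniqueDiffOn_Icc (zero_lt_one' ℝ))).1 (by simpa [one_add_one_eq_two] using h.contDiffOn i j)
  have hγT : ∀ r ∈ Icc (0 : ℝ) 1, (γ r)ᵀ = γ r := fun r hr =>
    transpose_eq_self (h.posDef r hr).posSemidef
  have hγ't : ∀ r ∈ Icc (0 : ℝ) 1, (curveDeriv γ r)ᵀ = curveDeriv γ r := fun r hr =>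
    transpose_curveDeriv hr hγT
  have hγ' (t : ℝ) (ht : t ∈ Icc (0 : ℝ) 1) :
      HasDerivWithinAt γ (curveDeriv γ t) (Icc 0 1) t :=
    hasDerivWithinAt_curveDeriv ht fun i j => (hC i j).1
  have hγ'' (t : ℝ) (ht : t ∈ Icc (0 : ℝ) 1) :
      HasDerivWithinAt (curveDeriv γ) (curveDeriv (curveDeriv γ) t) (Icc 0 1) t :=
    hasDerivWithinAt_curveDeriv ht fun i j => (hC i j).2.2.differentiableOn one_ne_zero
  set S : ℝ → Matrix (Fin n) (Fin n) ℝ := fun t => lyapunov (γ t) (curveDeriv γ t)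
  have hspec (t : ℝ) (ht : t ∈ Icc (0 : ℝ) 1) : S t * γ t + γ t * S t = curveDeriv γ t :=
    lyapunov_spec (h.posDef t ht) _
  have hS (t : ℝ) (ht : t ∈ Icc (0 : ℝ) 1) :
      HasDerivWithinAt S (-(S t * S t)) (Icc 0 1) t := by
    have hgeo : curveDeriv (curveDeriv γ) t = (2 : ℝ) • (S t * γ t * S t) :=
      (acceleration_eq_zero_iff (h.posDef t ht) (hγ't t ht) (transpose_curveDeriv ht hγ't)).1
        (h.acceleration_eq_zero t ht)
    have hd := hasDerivWithinAt_lyapunov (hγ' t ht) (hγ'' t ht) (h.posDef t ht)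
    refine hd.congr_deriv (eq_lyapunov (h.posDef t ht) ?_).symm
    change -(S t * S t) * γ t + γ t * -(S t * S t) = curveDeriv (curveDeriv γ) t -
      (S t * curveDeriv γ t + curveDeriv γ t * S t)
    rw [hgeo, ← hspec t ht, two_smul]
    noncomm_ring
  refine ⟨S 0, transpose_lyapunov (h.posDef 0 (by simp)) (hγ't 0 (by simp)), fun t ht => ?_⟩
  have := eq_conj_one_add_smul_of_ode (R := Matrix (Fin n) (Fin n) ℝ) (γ := γ) (S := S)
    (fun t ht => (hγ' t ht).congr_deriv (hspec t ht).symm) hS t ht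
  rwa [h.source] at this

open scoped Matrix.Norms.Operator in
/-- Conversely, these curves are geodesics as long as `1 + t S` stays positive definite. -/
theorem isBWGeodesic_conj {n : ℕ} {X S : Matrix (Fin n) (Fin n) ℝ} (hX : X.PosDef)
    (hA : ∀ t ∈ Icc (0 : ℝ) 1, (1 + t • S).PosDef) (hS : Sᵀ = S) :
    IsBWGeodesic (fun t => (1 + t • S) * X * (1 + t • S)) X ((1 + S) * X * (1 + S)) := by
  have hXT := transpose_eq_self hX.posSemidef
  have hpd (t : ℝ) (ht : t ∈ Icc (0 : ℝ) 1) : ((1 + t • S) * X * (1 + t • S)).PosDef := by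
    have := hX.mul_mul_conjTranspose_same (B := 1 + t • S)
      (Matrix.vecMul_injective_iff_isUnit.2 (hA t ht).isUnit)
    rwa [Matrix.conjTranspose_eq_transpose_of_trivial, transpose_eq_self (hA t ht).posSemidef]
      at this
  refine ⟨hpd, fun i j => ?_, by simp, by simp, fun t ht V hV => ?_⟩
  · refine ContDiff.contDiffOn ?_
    simp only [Matrix.mul_apply, Matrix.add_apply, Matrix.smul_apply, smul_eq_mul]
    fun_prop
  have h1 (r : ℝ) (hr : r ∈ Icc (0 : ℝ) 1) :
      curveDeriv (fun t : ℝ => (1 + t • S) * X * (1 + t • S)) r =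
        S * X * (1 + r • S) + (1 + r • S) * X * S :=
    curveDeriv_eq hr
      (hasDerivWithinAt_conj_one_add_smul (R := Matrix (Fin n) (Fin n) ℝ) X S (Icc 0 1) r)
  have h2 : curveDeriv (curveDeriv fun t : ℝ => (1 + t • S) * X * (1 + t • S)) t =
      (2 : ℝ) • (S * X * S) := by
    refine curveDeriv_eq ht (HasDerivWithinAt.congr ?_ h1 (h1 t ht))
    exact hasDerivWithinAt_deriv_conj_one_add_smul (R := Matrix (Fin n) (Fin n) ℝ) X S (Icc 0 1) t
  rw [bwAcceleration, h1 t ht, h2]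
  have hAT := transpose_eq_self (hA t ht).posSemidef
  have hu := isUnit_det (hA t ht)
  have hc : (1 + t • S) * S = S * (1 + t • S) := by
    simp [Matrix.add_mul, Matrix.mul_add]
  -- the Lyapunov solution of the velocity is `S (1 + t S)⁻¹`
  have hc' : (1 + t • S)⁻¹ * S = S * (1 + t • S)⁻¹ := by
    rw [← Matrix.mul_nonsing_inv_cancel_right (A := 1 + t • S) ((1 + t • S)⁻¹ * S) hu,
      Matrix.mul_assoc _ S, ← hc, Matrix.nonsing_inv_mul_cancel_left _ _ hu]
  have hL : S * (1 + t • S)⁻¹ = lyapunov ((1 + t • S) * X * (1 + t • S))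
      (S * X * (1 + t • S) + (1 + t • S) * X * S) := by
    refine eq_lyapunov (hpd t ht) ?_
    congr 1
    · rw [Matrix.mul_assoc S, Matrix.mul_assoc (1 + t • S),
        Matrix.nonsing_inv_mul_cancel_left _ _ hu, Matrix.mul_assoc]
    · rw [← hc', ← Matrix.mul_assoc, Matrix.mul_nonsing_inv_cancel_right _ _ hu]
  refine (acceleration_eq_zero_iff (hpd t ht) ?_ ?_).2 ?_ V hV
  · simp only [Matrix.transpose_add, Matrix.transpose_mul, hAT, hS, hXT, Matrix.mul_assoc]
    exact add_comm _ _
  · simp only [Matrix.transpose_smul, Matrix.transpose_mul, hS, hXT, Matrix.mul_assoc]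
  · rw [← hL]
    nth_rw 2 [← hc']
    congr 1
    calc S * X * S = S * ((1 + t • S)⁻¹ * (1 + t • S)) * X * ((1 + t • S) * (1 + t • S)⁻¹) * S := by
          rw [Matrix.nonsing_inv_mul _ hu, Matrix.mul_nonsing_inv _ hu, Matrix.mul_one,
            Matrix.mul_one]
      _ = _ := by simp only [Matrix.mul_assoc]

/-! ### Geodesics are minimizing -/

lemma posDef_one_add_smul_of_posDef {n : ℕ} {S : Matrix (Fin n) (Fin n) ℝ} (hS : (1 + S).PosDef)
    {t : ℝ} (ht : t ∈ Icc (0 : ℝ) 1) : (1 + t • S).PosDef := by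
  have hcomb : (1 + t • S : Matrix (Fin n) (Fin n) ℝ) = (1 - t) • 1 + t • (1 + S) := by
    rw [sub_smul, one_smul, smul_add]
    abel
  rw [hcomb]
  rcases ht.1.eq_or_lt with rfl | h0
  · simpa using Matrix.PosDef.one
  · exact (Matrix.PosDef.smul hS h0).posSemidef_add
      (Matrix.PosSemidef.one.smul (sub_nonneg.2 ht.2))

/-- If `1 + t S` is invertible for all `t` in `[0, 1]`, then `S` has no eigenvalue in `(-∞, -1]`. -/
lemma posDef_one_add_smul {n : ℕ} {S : Matrix (Fin n) (Fin n) ℝ} (hS : Sᵀ = S)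
    (hu : ∀ t ∈ Icc (0 : ℝ) 1, IsUnit (1 + t • S)) :
    ∀ t ∈ Icc (0 : ℝ) 1, (1 + t • S).PosDef := by
  have hB : (1 + S).IsHermitian := by
    simp [Matrix.IsHermitian, Matrix.conjTranspose_eq_transpose_of_trivial, hS]
  have h1 : (1 + S).PosDef := by
    refine hB.posDef_iff_eigenvalues_pos.2 fun i => ?_
    by_contra! hneg
    have hv := hB.mulVec_eigenvectorBasis i
    have hv0 : (hB.eigenvectorBasis i).ofLp ≠ 0 := by
      simpa using hB.eigenvectorBasis.orthonormal.ne_zero i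
    generalize hB.eigenvalues i = μ at *
    generalize (hB.eigenvectorBasis i).ofLp = v at *
    -- an eigenvalue `μ ≤ 0` of `1 + S` makes `1 + t S` singular at `t = 1 / (1 - μ)`
    have hμ : 0 < 1 - μ := by linarith
    refine hv0 (Matrix.mulVec_injective_iff_isUnit.2 (hu (1 - μ)⁻¹ ⟨by positivity, ?_⟩) ?_)
    · exact inv_le_one_of_one_le₀ (by linarith)
    · have hSv : S *ᵥ v = (μ - 1) • v := by
        rw [Matrix.add_mulVec, Matrix.one_mulVec] at hv
        rw [sub_smul, one_smul, ← hv, add_sub_cancel_left]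
      rw [Matrix.mulVec_zero, Matrix.add_mulVec, Matrix.one_mulVec, Matrix.smul_mulVec, hSv,
        smul_smul, ← neg_sub 1 μ, mul_neg, inv_mul_cancel₀ hμ.ne', neg_one_smul, add_neg_cancel]
  exact fun t ht => posDef_one_add_smul_of_posDef h1 ht

lemma posDef_mul_inv_of_commute {n : ℕ} {A B : Matrix (Fin n) (Fin n) ℝ} (hA : A.PosDef)
    (hB : B.PosDef) (h : Commute A B) : (A * B⁻¹).PosDef := by
  have hc : Commute A B⁻¹ := by
    have hu := isUnit_det hB
    rw [Commute, SemiconjBy, ← Matrix.mul_nonsing_inv_cancel_right (A := B) (B⁻¹ * A) hu,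
      Matrix.mul_assoc _ A, h.eq, Matrix.nonsing_inv_mul_cancel_left _ _ hu]
  have hnn : 0 ≤ A * B⁻¹ := hc.mul_nonneg hA.posSemidef.nonneg hB.inv.posSemidef.nonneg
  exact (Matrix.nonneg_iff_posSemidef.1 hnn).posDef_iff_isUnit.2 (hA.isUnit.mul hB.inv.isUnit)

lemma wasserstein_conj {n : ℕ} {X S : Matrix (Fin n) (Fin n) ℝ} (hX : X.PosDef)
    {s t : ℝ} (hs : (1 + s • S).PosDef) (ht : (1 + t • S).PosDef) :
    wasserstein (centredGaussian ((1 + s • S) * X * (1 + s • S)))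
      (centredGaussian ((1 + t • S) * X * (1 + t • S))) =
        ENNReal.ofReal |s - t| * ENNReal.ofReal (√((S * X * S).trace)) := by
  have hc : Commute (1 + t • S) (1 + s • S) :=
    (Commute.one_left _).add_left
      ((Commute.one_right _).add_right (((Commute.refl S).smul_left t).smul_right s))
  have hB := posDef_mul_inv_of_commute ht hs hc
  have hu := isUnit_det hs
  have hsT := transpose_eq_self hs.posSemidef
  have hG : ((1 + s • S) * X * (1 + s • S)).PosSemidef := by
    have := hX.posSemidef.mul_mul_conjTranspose_same (1 + s • S)
    rwa [Matrix.conjTranspose_eq_transpose_of_trivial, hsT] at this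
  have h1 : (1 + t • S) * (1 + s • S)⁻¹ * (1 + s • S) = 1 + t • S :=
    Matrix.nonsing_inv_mul_cancel_right _ _ hu
  have h2 : (1 + s • S) * ((1 + t • S) * (1 + s • S)⁻¹) = 1 + t • S := by
    rw [← Matrix.mul_assoc, ← hc.eq, Matrix.mul_nonsing_inv_cancel_right _ _ hu]
  have hW := wasserstein_eq hG hB
  generalize (1 + t • S) * (1 + s • S)⁻¹ = B at *
  have h3 : B * ((1 + s • S) * X * (1 + s • S)) * B = (1 + t • S) * X * (1 + t • S) := by
    calc B * ((1 + s • S) * X * (1 + s • S)) * B =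
        (B * (1 + s • S)) * X * ((1 + s • S) * B) := by simp only [Matrix.mul_assoc]
      _ = _ := by rw [h1, h2]
  have h4 : (1 - B) * ((1 + s • S) * X * (1 + s • S)) * (1 - B) =
      ((s - t) ^ 2) • (S * X * S) := by
    calc (1 - B) * ((1 + s • S) * X * (1 + s • S)) * (1 - B) =
        ((1 - B) * (1 + s • S)) * X * ((1 + s • S) * (1 - B)) := by simp only [Matrix.mul_assoc]
      _ = ((s - t) • S) * X * ((s - t) • S) := by
        rw [Matrix.sub_mul, Matrix.mul_sub, h1, h2, Matrix.one_mul, Matrix.mul_one,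
          add_sub_add_left_eq_sub, ← sub_smul]
      _ = _ := by
        rw [Matrix.smul_mul, Matrix.smul_mul, Matrix.mul_smul, smul_smul, sq]
  rw [h3, h4, Matrix.trace_smul, smul_eq_mul, Real.sqrt_mul (sq_nonneg _), Real.sqrt_sq_eq_abs,
    ENNReal.ofReal_mul (abs_nonneg _)] at hW
  exact hW

/-- Bures-Wasserstein geodesics give Wasserstein geodesics of Gaussian measures. -/
theorem IsBWGeodesic.isGaussianWassersteinGeodesic {n : ℕ} {γ : ℝ → Matrix (Fin n) (Fin n) ℝ}
    {X Y : Matrix (Fin n) (Fin n) ℝ} (h : IsBWGeodesic γ X Y) :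
    IsGaussianWassersteinGeodesic (fun t => centredGaussian (γ t)) (centredGaussian X)
      (centredGaussian Y) := by
  obtain ⟨S, hS, hγ⟩ := h.exists_eq
  have h0 : (0 : ℝ) ∈ Icc (0 : ℝ) 1 := by simp
  have h1 : (1 : ℝ) ∈ Icc (0 : ℝ) 1 := by simp
  have hX : X.PosDef := h.source ▸ h.posDef 0 h0
  have hu (t : ℝ) (ht : t ∈ Icc (0 : ℝ) 1) : IsUnit (1 + t • S) := by
    have h' := (h.posDef t ht).isUnit
    rw [hγ t ht, Matrix.isUnit_iff_isUnit_det, Matrix.det_mul] at h'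
    exact (Matrix.isUnit_iff_isUnit_det _).2 (isUnit_of_mul_isUnit_right h')
  have hA := posDef_one_add_smul hS hu
  have hW (s : ℝ) (hs : s ∈ Icc (0 : ℝ) 1) (t : ℝ) (ht : t ∈ Icc (0 : ℝ) 1) :
      wasserstein (centredGaussian (γ s)) (centredGaussian (γ t)) =
        ENNReal.ofReal |s - t| * ENNReal.ofReal (√((S * X * S).trace)) := by
    rw [hγ s hs, hγ t ht, wasserstein_conj hX (hA s hs) (hA t ht)]
  have hXY : wasserstein (centredGaussian X) (centredGaussian Y) =
      ENNReal.ofReal (√((S * X * S).trace)) := by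
    simpa [h.source, h.target] using hW 0 h0 1 h1
  refine ⟨fun t ht => ⟨γ t, h.posDef t ht, rfl⟩, by simp [h.source], by simp [h.target], ?_, ?_⟩
  · rw [hXY]
    exact ENNReal.ofReal_ne_top
  · intro s hs t ht
    rw [hXY]
    exact hW s hs t ht

/-! ### The curve of the polar factor -/

/-- The curve built from the polar factor is `t ↦ (1 + t (A - 1)) X (1 + t (A - 1))`, where
`A = Y^{1/2} P X^{-1/2}` is the transport map. -/
lemma bwCurve_eq {n : ℕ} {X Y P : Matrix (Fin n) (Fin n) ℝ} (hX : X.PosDef)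
    (hA : (CFC.sqrt Y * P * (CFC.sqrt X)⁻¹)ᵀ = CFC.sqrt Y * P * (CFC.sqrt X)⁻¹) :
    bwCurve X Y P = fun t =>
      (1 + t • (CFC.sqrt Y * P * (CFC.sqrt X)⁻¹ - 1)) * X *
        (1 + t • (CFC.sqrt Y * P * (CFC.sqrt X)⁻¹ - 1)) := by
  funext t
  have h1 : CFC.sqrt Y * P = CFC.sqrt Y * P * (CFC.sqrt X)⁻¹ * CFC.sqrt X :=
    (Matrix.nonsing_inv_mul_cancel_right _ _ (isUnit_det (posDef_sqrt hX))).symm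
  rw [bwCurve]
  generalize CFC.sqrt Y * P * (CFC.sqrt X)⁻¹ = A at *
  rw [h1]
  have h2 : (1 - t) • CFC.sqrt X + t • (A * CFC.sqrt X) =
      (1 + t • (A - 1)) * CFC.sqrt X := by
    simp only [Matrix.add_mul, Matrix.smul_mul, Matrix.sub_mul, Matrix.one_mul, smul_sub, sub_smul,
      one_smul]
    abel
  have h3 : (1 + t • (A - 1))ᵀ = 1 + t • (A - 1) := by simp [hA]
  rw [h2, Matrix.transpose_mul, h3, transpose_eq_self (posDef_sqrt hX).posSemidef,
    Matrix.mul_assoc, ← Matrix.mul_assoc (CFC.sqrt X), sqrt_mul_sqrt hX, Matrix.mul_assoc]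

theorem isBWGeodesic_bwCurve {n : ℕ} {X Y P : Matrix (Fin n) (Fin n) ℝ} (hX : X.PosDef)
    (hY : Y.PosDef) (hP : IsPolarFactor P (CFC.sqrt Y * CFC.sqrt X)) :
    IsBWGeodesic (bwCurve X Y P) X Y := by
  obtain ⟨hA, hAX, -⟩ := transport_of_isPolarFactor hX hY hP
  have hAT := transpose_eq_self hA.posSemidef
  rw [bwCurve_eq hX hAT]
  generalize CFC.sqrt Y * P * (CFC.sqrt X)⁻¹ = A at *
  have h := isBWGeodesic_conj (S := A - 1) hX
    (fun t ht => posDef_one_add_smul_of_posDef (by rwa [add_sub_cancel]) ht) (by simp [hAT])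
  rwa [add_sub_cancel, hAX] at h

end BuresWasserstein

theorem mainTheorem8 (n : ℕ) (X Y : Matrix (Fin n) (Fin n) ℝ) (hX : X.PosDef) (hY : Y.PosDef) :
    -- every BW geodesic from `X` to `Y` is matched by a Wasserstein geodesic of Gaussians
    (∀ γ : ℝ → Matrix (Fin n) (Fin n) ℝ, BuresWasserstein.IsBWGeodesic γ X Y →
      BuresWasserstein.IsGaussianWassersteinGeodesic
        (fun t => BuresWasserstein.centredGaussian (γ t))
        (BuresWasserstein.centredGaussian X) (BuresWasserstein.centredGaussian Y)) ∧
    -- the unitary polar factor `P` of `Y^{1/2} X^{1/2}` exists and is unique, it yields such a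
    -- BW geodesic, and `Y^{1/2} P X^{-1/2}` is the Gaussian optimal transport map
    (∃! P : Matrix (Fin n) (Fin n) ℝ,
      BuresWasserstein.IsPolarFactor P (CFC.sqrt Y * CFC.sqrt X)) ∧
    (∀ P : Matrix (Fin n) (Fin n) ℝ,
      BuresWasserstein.IsPolarFactor P (CFC.sqrt Y * CFC.sqrt X) →
        BuresWasserstein.IsBWGeodesic (BuresWasserstein.bwCurve X Y P) X Y ∧
        BuresWasserstein.IsOptimalTransportMap
          (Matrix.toEuclideanCLM (𝕜 := ℝ) (CFC.sqrt Y * P * (CFC.sqrt X)⁻¹))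
          (BuresWasserstein.centredGaussian X) (BuresWasserstein.centredGaussian Y) ∧
        CFC.sqrt Y * P * (CFC.sqrt X)⁻¹ =
          CFC.sqrt Y * (CFC.sqrt (CFC.sqrt Y * X * CFC.sqrt Y))⁻¹ * CFC.sqrt Y) := by
  refine ⟨fun γ h => h.isGaussianWassersteinGeodesic,
    BuresWasserstein.existsUnique_isPolarFactor ?_, fun P hP => ?_⟩
  · rw [Matrix.det_mul]
    exact (BuresWasserstein.isUnit_det (BuresWasserstein.posDef_sqrt hY)).mul
      (BuresWasserstein.isUnit_det (BuresWasserstein.posDef_sqrt hX))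
  · obtain ⟨hA, hAX, hformula⟩ := BuresWasserstein.transport_of_isPolarFactor hX hY hP
    have hopt := BuresWasserstein.isOptimalTransportMap_of_posDef hX.posSemidef hA
    rw [hAX] at hopt
    exact ⟨BuresWasserstein.isBWGeodesic_bwCurve hX hY hP, hopt, hformula⟩
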